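/- **Setting.** For $\lambda>0$ and $u\in\mathbb R^m$ let $\mathrm{Softmax}_\lambda(u)_i=e^{\lambda u_i}/\sum_{j}e^{\lambda u_j}$, applied column by column to matrices. An $H$-head attention layer with inverse temperature $\lambda$ is a map $$\mathrm{Attn}(Z)=\sum_{h=1}^H W_V^{(h)}Z\,\mathrm{Softmax}_\lambda\big((W_K^{(h)}Z)^\top W_Q^{(h)}Z\big),$$ with $W_K^{(h)},W_Q^{(h)}\in\mathbb R^{d_h\times d_{\rm in}}$ and $W_V^{(h)}\in\mathbb R^{d_{\rm out}\times d_{\rm in}}$; write $W_{KQ}^{(h)}=(W_K^{(h)})^\top W_Q^{(h)}$. The class $\mathcal T(H,W,K,C_{KQ},C_V)$ with inverse temperature $\lambda$ consists of the maps $$\tau=T\circ\mathrm{Attn}^{(K)}\circ\cdots\circ\mathrm{Attn}^{(1)}\circ P,$$ where each $\mathrm{Attn}^{(j)}$ is an $H$-head attention layer with inverse temperature $\lambda$ mapping token dimension $d_j$ to token dimension $d_{j+1}$, $P(X)=\begin{bmatrix}X&0\\ I_n&0\\ 0&1\end{bmatrix}$ for an input $X$ with $n$ tokens, and $T$ deletes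 the last token. Here $W$ is the maximum of all token dimensions $d_1,\dots,d_{K+1}$ and all head dimensions $d_h$, while $C_V>0$ and $C_{KQ}>0$ are the maxima over all layers and heads of $\|W_V\|_F$ and $\|W_{KQ}\|_F$. A scalar $t$ is regarded as a one-token input of dimension $1$ ($n=1$), and the output is also one scalar token. **Proposition (Approximation of $\exp(-t/2)$).** There are an absolute constant $c>0$ and a fixed real polynomial $p$ such that the following holds. For every $\epsilon\in(0,1)$ and every $C_X>0$ there is a Transformer $f_\alpha\in\mathcal T(H,W,K,C_{KQ},C_V)$, for some $H,W,K,C_{KQ},C_V$ and some inverse temperature $\lambda>0$, with $$|f_\alpha(t)-\exp(-t/2)|\le\epsilon\qquad\text{for all }0\le t\le C_X .$$ Moreover, if $C_X\ge1$, then with $\delta:=\max\{1/\epsilon,2\}$ the parameters of this $f_\alpha$ satisfy $$H\le c\ln\delta,\qquad W\le c\ln\delta,\qquad K\le c\ln^2\delta,$$ $$C_V\le\exp(c\ln^2\delta)\cdot c\sqrt{\ln\delta},\qquad C_{KQ}\le c\sqrt{\ln^2\delta\,(\ln^2\delta+\ln C_X)},$$ $$\lambda\le\exp(c\ln^4\delta)\cdot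 c\,(\ln\delta)^{p(\ln\delta)}\cdot\ln\max\{C_X,2\}.$$ -/

import Mathlib

open Matrix

noncomputable section

/-- Frobenius norm of a real matrix. -/
def frobeniusNorm {m n : ℕ} (A : Matrix (Fin m) (Fin n) ℝ) : ℝ :=
  @norm _ (Matrix.frobeniusNormedAddCommGroup).toNorm A

/-- Softmax with inverse temperature `lam` of a vector. -/
def softmaxVec (lam : ℝ) {d : ℕ} (u : Fin d → ℝ) : Fin d → ℝ :=
  fun i => Real.exp (lam * u i) / ∑ j, Real.exp (lam * u j)

/-- Column-wise softmax with inverse temperature `lam` of a matrix. -/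
def softmaxCols (lam : ℝ) {d n : ℕ} (X : Matrix (Fin d) (Fin n) ℝ) : Matrix (Fin d) (Fin n) ℝ :=
  Matrix.of fun i k => softmaxVec lam (fun l => X l k) i

/-- The weights of one attention head, with its own key/query dimension `dh`. -/
structure AttnHead (din dout : ℕ) where
  dh : ℕ
  WK : Matrix (Fin dh) (Fin din) ℝ
  WQ : Matrix (Fin dh) (Fin din) ℝ
  WV : Matrix (Fin dout) (Fin din) ℝ

/-- `W_KQ = W_Kᵀ W_Q`. -/
def AttnHead.WKQ {din dout : ℕ} (h : AttnHead din dout) : Matrix (Fin din) (Fin din) ℝ :=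
  h.WKᵀ * h.WQ

/-- A multi-head self-attention layer acting on a sequence of `n` tokens. -/
def attnLayer (lam : ℝ) {H din dout n : ℕ} (L : Fin H → AttnHead din dout)
    (Z : Matrix (Fin din) (Fin n) ℝ) : Matrix (Fin dout) (Fin n) ℝ :=
  ∑ h, (L h).WV * Z * softmaxCols lam (((L h).WK * Z)ᵀ * ((L h).WQ * Z))

/-- The weights of a stack of `K` consecutive `H`-head attention layers with input token dimension
`a` and output token dimension `b`; the first layer comes first. -/
inductive AttnStack (H : ℕ) : ℕ → ℕ → ℕ → Type
  | nil (a : ℕ) : AttnStack H 0 a a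
  | cons {K a b c : ℕ} (first : Fin H → AttnHead a b) (rest : AttnStack H K b c) :
      AttnStack H (K + 1) a c

namespace AttnStack

/-- The composition `Attn⁽ᴷ⁾ ∘ ⋯ ∘ Attn⁽¹⁾`. -/
def apply (lam : ℝ) {H n : ℕ} : {K a b : ℕ} → AttnStack H K a b →
    Matrix (Fin a) (Fin n) ℝ → Matrix (Fin b) (Fin n) ℝ
  | _, _, _, nil _, Z => Z
  | _, _, _, cons first rest, Z => rest.apply lam (attnLayer lam first Z)

/-- All token dimensions `d_1, …, d_{K+1}` and all head dimensions. -/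
def widths {H : ℕ} : {K a b : ℕ} → AttnStack H K a b → Set ℕ
  | _, _, _, nil a => {a}
  | _, a, _, cons first rest => {a} ∪ Set.range (fun h => (first h).dh) ∪ rest.widths

/-- The Frobenius norms of all value matrices. -/
def vNorms {H : ℕ} : {K a b : ℕ} → AttnStack H K a b → Set ℝ
  | _, _, _, nil _ => ∅
  | _, _, _, cons first rest => Set.range (fun h => frobeniusNorm (first h).WV) ∪ rest.vNorms

/-- The Frobenius norms of all matrices `W_KQ`. -/
def kqNorms {H : ℕ} : {K a b : ℕ} → AttnStack H K a b → Set ℝ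
  | _, _, _, nil _ => ∅
  | _, _, _, cons first rest => Set.range (fun h => frobeniusNorm (first h).WKQ) ∪ rest.kqNorms

end AttnStack

/-- The preprocessing layer: append a zero token and the one-hot positional encoding,
`P(X) = [X 0; I_{n+1}]`. -/
def preprocess {d n : ℕ} (X : Matrix (Fin d) (Fin n) ℝ) :
    Matrix (Fin (d + (n + 1))) (Fin (n + 1)) ℝ :=
  Matrix.of fun i k =>
    Fin.addCases (motive := fun _ => ℝ)
      (fun r => Fin.snoc (α := fun _ => ℝ) (X r) 0 k)
      (fun q => (1 : Matrix (Fin (n + 1)) (Fin (n + 1)) ℝ) q k) i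

/-- The truncation layer: delete the last token. -/
def truncateLast {d n : ℕ} (Y : Matrix (Fin d) (Fin (n + 1)) ℝ) : Matrix (Fin d) (Fin n) ℝ :=
  Y.submatrix id Fin.castSucc

/-- The class `𝒯(H, W, K, C_KQ, C_V)` of attention-only Transformers
`T ∘ Attn⁽ᴷ⁾ ∘ ⋯ ∘ Attn⁽¹⁾ ∘ P` from `ℝ^{d × n}` to `ℝ^{dout × n}`, all of whose layers have inverse
temperature `lam`. -/
def transformerClass (d n dout H W K : ℕ) (CKQ CV lam : ℝ) :
    Set (Matrix (Fin d) (Fin n) ℝ → Matrix (Fin dout) (Fin n) ℝ) :=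
  {τ | 0 < CKQ ∧ 0 < CV ∧ 0 < lam ∧ ∃ S : AttnStack H K (d + (n + 1)) dout,
    IsGreatest S.widths W ∧ IsGreatest S.kqNorms CKQ ∧ IsGreatest S.vNorms CV ∧
    ∀ X, τ X = truncateLast (S.apply lam (preprocess X))}

end

theorem frobeniusNorm_eq_sqrt {m n : ℕ} (A : Matrix (Fin m) (Fin n) ℝ) :
    frobeniusNorm A = √(∑ i, ∑ j, A i j ^ 2) := by
  unfold frobeniusNorm
  rw [Matrix.frobenius_norm_def, Real.sqrt_eq_rpow]
  simp

/-- A head whose first-token attention weight is the logistic function of `-(t / 2 + log δ)`. -/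
noncomputable def expHead (δ : ℝ) : AttnHead (1 + (1 + 1)) 1 where
  dh := 1
  WK := !![0, 0, 1]
  WQ := !![1 / 2, Real.log δ, 0]
  WV := !![0, δ, 0]

/-- The stack consisting of the single head `expHead δ`. -/
noncomputable def expStack (δ : ℝ) : AttnStack 1 1 (1 + (1 + 1)) 1 :=
  .cons (fun _ => expHead δ) (.nil 1)

theorem preprocess_scalar (X : Matrix (Fin 1) (Fin 1) ℝ) :
    preprocess X = (!![X 0 0, 0; 1, 0; 0, 1] : Matrix (Fin 3) (Fin 2) ℝ) := by
  ext i k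
  fin_cases i <;> fin_cases k <;> rfl

theorem expStack_apply {δ : ℝ} (hδ : 0 < δ) (t : ℝ) :
    truncateLast ((expStack δ).apply 1 (preprocess !![t])) 0 0 =
      δ / (1 + δ * Real.exp (t / 2)) := by
  have h : Real.exp (t / 2 + Real.log δ) = δ * Real.exp (t / 2) := by
    rw [Real.exp_add, Real.exp_log hδ, mul_comm]
  rw [preprocess_scalar]
  simp only [expStack, AttnStack.apply, attnLayer, Finset.univ_unique, Finset.sum_singleton]
  change ((!![0, δ, 0] : Matrix (Fin 1) (Fin 3) ℝ) * !![t, 0; 1, 0; 0, 1] *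
    softmaxCols 1 (((!![0, 0, 1] : Matrix (Fin 1) (Fin 3) ℝ) * !![t, 0; 1, 0; 0, 1])ᵀ *
      ((!![1 / 2, Real.log δ, 0] : Matrix (Fin 1) (Fin 3) ℝ) * !![t, 0; 1, 0; 0, 1]))) 0 0 = _
  rw [← h]
  simp [softmaxCols, softmaxVec, Matrix.mul_apply, Fin.sum_univ_succ, div_eq_mul_inv, mul_comm]

theorem expHead_WKQ (δ : ℝ) :
    (expHead δ).WKQ = (!![0, 0, 0; 0, 0, 0; 1 / 2, Real.log δ, 0] : Matrix (Fin 3) (Fin 3) ℝ) := by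
  change (!![0, 0, 1] : Matrix (Fin 1) (Fin 3) ℝ)ᵀ * !![1 / 2, Real.log δ, 0] = _
  ext i j
  fin_cases i <;> fin_cases j <;> simp [Matrix.mul_apply]

theorem frobeniusNorm_expHead_WV {δ : ℝ} (hδ : 0 ≤ δ) : frobeniusNorm (expHead δ).WV = δ := by
  rw [frobeniusNorm_eq_sqrt]
  simp [expHead, Fin.sum_univ_succ, Real.sqrt_sq hδ]

theorem frobeniusNorm_expHead_WKQ (δ : ℝ) :
    frobeniusNorm (expHead δ).WKQ = √(1 / 4 + Real.log δ ^ 2) := by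
  rw [frobeniusNorm_eq_sqrt, expHead_WKQ]
  simp [Fin.sum_univ_succ]
  norm_num

theorem expStack_mem_transformerClass {δ : ℝ} (hδ : 0 < δ) :
    (fun X => truncateLast ((expStack δ).apply 1 (preprocess X))) ∈
      transformerClass 1 1 1 1 3 1 √(1 / 4 + Real.log δ ^ 2) δ 1 := by
  refine ⟨by positivity, hδ, one_pos, expStack δ, ?_, ?_, ?_, fun _ => rfl⟩
  · constructor
    · simp [expStack, AttnStack.widths]
    · rintro x hx
      simp only [expStack, AttnStack.widths, expHead, Set.mem_union, Set.mem_singleton_iff,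
        Set.mem_range] at hx
      rcases hx with (rfl | ⟨_, rfl⟩) | rfl <;> norm_num
  · simp [expStack, AttnStack.kqNorms, frobeniusNorm_expHead_WKQ]
  · simp [expStack, AttnStack.vNorms, frobeniusNorm_expHead_WV hδ.le]

theorem abs_logistic_sub_exp_le {δ t : ℝ} (hδ : 0 < δ) (ht : 0 ≤ t) :
    |δ / (1 + δ * Real.exp (t / 2)) - Real.exp (-t / 2)| ≤ 1 / δ := by
  have hE : 1 ≤ Real.exp (t / 2) := Real.one_le_exp (by positivity)
  set E := Real.exp (t / 2) with hEdef
  have hpos : 0 < E := by positivity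
  have hinv : Real.exp (-t / 2) = 1 / E := by
    rw [neg_div, Real.exp_neg, one_div]
  have hdiff : δ / (1 + δ * E) - 1 / E = -(1 / (E * (1 + δ * E))) := by
    field_simp
    ring
  rw [hinv, hdiff, abs_neg, abs_of_nonneg (by positivity)]
  apply one_div_le_one_div_of_le hδ
  have h1 : δ ≤ 1 + δ * E := by nlinarith
  nlinarith

theorem mainTheorem8 :
    ∃ (c : ℝ) (polylog : Polynomial ℝ), 0 < c ∧
      ∀ ε : ℝ, 0 < ε → ε < 1 → ∀ CX : ℝ, 0 < CX →
        ∃ (H W K : ℕ) (CKQ CV lam : ℝ), ∃ f ∈ transformerClass 1 1 1 H W K CKQ CV lam,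
          (∀ t : ℝ, 0 ≤ t → t ≤ CX → |f !![t] 0 0 - Real.exp (-t / 2)| ≤ ε) ∧
          (1 ≤ CX → ∀ δ : ℝ, δ = max (1 / ε) 2 →
            (H : ℝ) ≤ c * Real.log δ ∧
            (W : ℝ) ≤ c * Real.log δ ∧
            (K : ℝ) ≤ c * Real.log δ ^ 2 ∧
            CV ≤ Real.exp (c * Real.log δ ^ 2) * (c * √(Real.log δ)) ∧
            CKQ ≤ c * √(Real.log δ ^ 2 * (Real.log δ ^ 2 + Real.log CX)) ∧
            lam ≤ Real.exp (c * Real.log δ ^ 4) *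
              (c * (Real.log δ ^ (polylog.eval (Real.log δ)) * Real.log (max CX 2)))) := by
  refine ⟨10, 0, by norm_num, fun ε hε _ CX _ => ?_⟩
  have hδ2 : 2 ≤ max (1 / ε) 2 := le_max_right _ _
  have hδ : 0 < max (1 / ε) 2 := by linarith
  refine ⟨1, 3, 1, _, _, 1, _, expStack_mem_transformerClass hδ, fun t ht _ => ?_, ?_⟩
  · simp only [expStack_apply hδ]
    refine (abs_logistic_sub_exp_le hδ ht).trans ?_
    rw [one_div_le hδ hε]
    exact le_max_left _ _
  · rintro hCX δ rfl
    have hlog2 : 0.6 ≤ Real.log 2 := by linarith [Real.log_two_gt_d9]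
    have hL : 0.6 ≤ Real.log (max (1 / ε) 2) := hlog2.trans (Real.log_le_log (by norm_num) hδ2)
    have hexp : Real.exp (Real.log (max (1 / ε) 2)) = max (1 / ε) 2 := Real.exp_log hδ
    have hlogCX : 0 ≤ Real.log CX := Real.log_nonneg hCX
    have hlogmax : 0.6 ≤ Real.log (max CX 2) :=
      hlog2.trans (Real.log_le_log (by norm_num) (le_max_right _ _))
    set L := Real.log (max (1 / ε) 2)
    have hL2 : 0.36 ≤ L ^ 2 := by nlinarith
    refine ⟨?_, ?_, ?_, ?_, ?_, ?_⟩
    · push_cast; linarith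
    · push_cast; linarith
    · push_cast; linarith
    · rw [← hexp]
      have hsqrt : 0.6 ≤ √L := Real.le_sqrt_of_sq_le (by linarith)
      have hle : Real.exp L ≤ Real.exp (10 * L ^ 2) := Real.exp_le_exp.2 (by nlinarith)
      exact hle.trans (le_mul_of_one_le_right (Real.exp_pos _).le (by linarith))
    · rw [Real.sqrt_le_left (by positivity), mul_pow, Real.sq_sqrt (by positivity)]
      nlinarith [mul_nonneg (sq_nonneg L) hlogCX]
    · have hle : 1 ≤ Real.exp (10 * L ^ 4) := Real.one_le_exp (by positivity)
      rw [Polynomial.eval_zero, Real.rpow_zero, one_mul]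
      exact one_le_mul_of_one_le_of_one_le hle (by linarith)
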